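/- Let $\mathcal P=\langle X\mid\mathcal R\rangle$ be a semigroup presentation, where $\mathcal R$ is a (possibly infinite) set of ordered pairs of nonempty words over the (possibly infinite) alphabet $X$ such that $(u,v)\in\mathcal R$ implies $(v,u)\notin\mathcal R$, and let $w$ be a nonempty word over $X$. An atomic diagram $(p,u=v,q)$, where $p,q$ are words and $(u,v)\in\mathcal R\cup\mathcal R^{-1}$, is the labelled plane graph with one cell (top path labelled $u$, bottom path labelled $v$) between a left segment labelled $p$ and a right segment labelled $q$; its top path is labelled $puq$ and its bottom path $pvq$. A diagram over $\mathcal P$ is a trivial diagram (a segment labelled by a word) or a concatenation of atomic diagrams (bottom path of each identified with the equally labelled top path of the next), considered up to isotopy of labelled plane graphs; it is a $(w,w)$-diagram if its top and bottom labels are both $w$. The diagram group $\mathcal D(\mathcal P,w)$ is the group of $(w,w)$-diagrams modulo insertion and removal of dipoles (pairs of mutually inverse cells, the bottom path of the first being the top path of the second), with concatenation as multiplication. For $g\in\mathcal D(\mathcal P,w)$ let $\#(g)$ be the number of cells in a diagram representing $g$ with the minimal number of cells, and let $\mathrm{dist}_d(g,h)=\#(g^{-1}h)$ be the diagram metric.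 Suppose that $G=\mathcal D(\mathcal P,w)$ is finitely generated and has property B, that is, there is a constant $c>0$ with $\mathrm{dist}_d(g,h)\le c\,\mathrm{dist}(g,h)$ and $\mathrm{dist}(g,h)\le c\,\mathrm{dist}_d(g,h)$ for all $g,h\in G$, where $\mathrm{dist}$ is the word metric of a finite generating set. Then the Hilbert space compression of $G$ is at least $1/2$. Here the Hilbert space compression of $G$, with the word metric $\mathrm{dist}$ of any finite generating set, is the supremum in $[0,\infty]$ (equal to $0$ if there are none) of all $\alpha\ge0$ for which there are a separable Hilbert space $H$, a map $f\colon G\to H$ and constants $C,D>0$ such that $f$ is a uniform embedding with $\rho_1(r)=Cr^\alpha$ and $\rho_2(r)=Dr$, i.e. $\rho_1,\rho_2\colon[0,\infty)\to[0,\infty)$ are non-decreasing, tend to $+\infty$ as $r\to+\infty$, and $\rho_1(\mathrm{dist}(g,h))\le\|f(g)-f(h)\|\le\rho_2(\mathrm{dist}(g,h))$ for all $g,h\in G$. -/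

import Mathlib

open scoped NNReal ENNReal

universe u

namespace DiagramGroups

/-! ### Semigroup presentations and atomic diagrams -/

/-- A semigroup presentation `⟨X ∣ R⟩`: the defining relations are ordered pairs of nonempty
words over `X`, and `(u, v) ∈ R` implies `(v, u) ∉ R`. Neither `X` nor `R` has to be finite. -/
structure Presentation (X : Type u) where
  rels : Set (List X × List X)
  fst_ne_nil : ∀ r ∈ rels, r.1 ≠ []
  snd_ne_nil : ∀ r ∈ rels, r.2 ≠ []
  asymm : ∀ r ∈ rels, r.swap ∉ rels

variable {X : Type u} {P : Presentation X}

/-- An atomic diagram `(p, u = v, q)` with `(u, v) ∈ R ∪ R⁻¹`: one cell, with top label `u` and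
bottom label `v`, between a left segment labelled `p` and a right segment labelled `q`. -/
@[ext] structure Atomic (P : Presentation X) where
  p : List X
  u : List X
  v : List X
  q : List X
  mem : (u, v) ∈ P.rels ∨ (v, u) ∈ P.rels

/-- The label of the top path. -/
def Atomic.top (a : Atomic P) : List X := a.p ++ a.u ++ a.q

/-- The label of the bottom path. -/
def Atomic.bot (a : Atomic P) : List X := a.p ++ a.v ++ a.q

/-- The mirror image `(p, v = u, q)`. -/
def Atomic.inv (a : Atomic P) : Atomic P := ⟨a.p, a.v, a.u, a.q, a.mem.symm⟩

/-! ### Diagrams -/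

/-- The atomic diagrams in the list can be concatenated in the given order (each bottom label is
the next top label), starting with top label `w` and ending with bottom label `w'`. -/
def Composable : List (Atomic P) → List X → List X → Prop
  | [], w, w' => w = w'
  | a :: L, w, w' => a.top = w ∧ Composable L a.bot w'

theorem Composable.append {L M : List (Atomic P)} {w w' w'' : List X}
    (h : Composable L w w') (k : Composable M w' w'') : Composable (L ++ M) w w'' := by
  induction L generalizing w with
  | nil => cases h; exact k
  | cons a L ih => exact ⟨h.1, ih h.2⟩

theorem Composable.reverse {L : List (Atomic P)} {w w' : List X}
    (h : Composable L w w') : Composable (L.map Atomic.inv).reverse w' w := by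
  induction L generalizing w with
  | nil => exact Eq.symm h
  | cons a L ih =>
    rw [List.map_cons, List.reverse_cons]
    exact (ih h.2).append ⟨rfl, h.1⟩

/-- A `(w, w')`-diagram, presented as a concatenation of atomic diagrams (the empty concatenation
is the trivial diagram). The plane graph that it describes is spelled out below, and different
concatenations describe the same diagram when these graphs are isotopic. -/
@[ext] structure Diagram (P : Presentation X) (w w' : List X) where
  atoms : List (Atomic P)
  composable : Composable atoms w w'

namespace Diagram

/-- The trivial diagram `ε(w)`. -/
def trivial (w : List X) : Diagram P w w := ⟨[], rfl⟩

/-- An atomic diagram as a diagram. -/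
def ofAtomic (a : Atomic P) : Diagram P a.top a.bot := ⟨[a], rfl, rfl⟩

/-- The mirror image of an atomic diagram as a diagram. -/
def ofAtomicInv (a : Atomic P) : Diagram P a.bot a.top := ⟨[a.inv], rfl, rfl⟩

/-- Concatenation: the bottom path of `Δ` is identified with the top path of `Δ'`. -/
def concat {w₁ w₂ w₃ : List X} (Δ : Diagram P w₁ w₂) (Δ' : Diagram P w₂ w₃) : Diagram P w₁ w₃ :=
  ⟨Δ.atoms ++ Δ'.atoms, Δ.composable.append Δ'.composable⟩

/-- The mirror image `Δ⁻¹`. -/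
def mirror {w w' : List X} (Δ : Diagram P w w') : Diagram P w' w :=
  ⟨(Δ.atoms.map Atomic.inv).reverse, Δ.composable.reverse⟩

/-- The number of cells of a diagram: each atomic factor contributes exactly one. -/
def numCells {w w' : List X} (Δ : Diagram P w w') : ℕ := Δ.atoms.length

end Diagram

/-! ### The labelled plane graph of a diagram and isotopy -/

/-- Names for the edges of a diagram: `top i` is the `i`-th edge of its top path, and `inner k j`
is the `j`-th edge on the bottom path of its `k`-th cell. -/
inductive Edge where
  | top (i : ℕ)
  | inner (k j : ℕ)

/-- A cell of a diagram: its boundary paths (as sequences of edges) and their labels. -/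
@[ext] structure Cell (X : Type u) where
  topPath : List Edge
  topLabel : List X
  botPath : List Edge
  botLabel : List X

/-- Rename the edges of a cell. -/
def Cell.rename (τ : Edge → Edge) (c : Cell X) : Cell X :=
  ⟨c.topPath.map τ, c.topLabel, c.botPath.map τ, c.botLabel⟩

/-- The cell that an atomic diagram `a`, glued below the path `e`, attaches as the `k`-th cell:
its top path is the segment of `e` between the first `|p|` and the last `|q|` edges, and its
bottom path consists of `|v|` new edges. -/
def attachedCell (k : ℕ) (e : List Edge) (a : Atomic P) : Cell X where
  topPath := (e.drop a.p.length).take a.u.length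
  topLabel := a.u
  botPath := (List.range a.v.length).map (Edge.inner k)
  botLabel := a.v

/-- The bottom path after the atomic diagram `a` has been glued below the path `e`. -/
def nextPath (k : ℕ) (e : List Edge) (a : Atomic P) : List Edge :=
  e.take a.p.length ++ (attachedCell k e a).botPath ++ e.drop (a.p.length + a.u.length)

/-- All cells obtained by gluing the atomic diagrams of the list, one after the other, below the
path `e`; they are numbered from `k` on. -/
def cellsFrom : ℕ → List Edge → List (Atomic P) → List (Cell X)
  | _, _, [] => []
  | k, e, a :: L => attachedCell k e a :: cellsFrom (k + 1) (nextPath k e a) L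

/-- The bottom path that results from this gluing. -/
def botFrom : ℕ → List Edge → List (Atomic P) → List Edge
  | _, e, [] => e
  | k, e, a :: L => botFrom (k + 1) (nextPath k e a) L

namespace Diagram

variable {w w' : List X}

/-- The top path of a `(w, w')`-diagram. -/
def topPath (_Δ : Diagram P w w') : List Edge := (List.range w.length).map Edge.top

/-- The cells of a diagram. -/
def cells (Δ : Diagram P w w') : List (Cell X) := cellsFrom 0 Δ.topPath Δ.atoms

/-- The bottom path of a diagram. -/
def botPath (Δ : Diagram P w w') : List Edge := botFrom 0 Δ.topPath Δ.atoms

/-- Two `(w, w')`-diagrams are isotopic as labelled plane graphs: some bijection between their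
edges carries the top path to the top path, the bottom path to the bottom path, and the cells
bijectively to the cells, respecting the top and bottom paths of the cells and all labels.
(Every edge lies on the top path or on the boundary of a cell, so that its label is preserved,
and the vertices are the endpoints of edges, identified as prescribed by these paths; only
finitely many edge names occur in a diagram, so a bijection between the edges of two diagrams is
the same as the restriction of a permutation of all edge names.) -/
def Isotopic (Δ Δ' : Diagram P w w') : Prop :=
  ∃ τ : Equiv.Perm Edge,
    Δ.topPath.map τ = Δ'.topPath ∧
    Δ.botPath.map τ = Δ'.botPath ∧
    (Δ.cells.map (Cell.rename τ)).Perm Δ'.cells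

theorem Isotopic.refl (Δ : Diagram P w w') : Isotopic Δ Δ := by
  refine ⟨Equiv.refl _, by simp, by simp, ?_⟩
  have : Cell.rename (X := X) (Equiv.refl Edge) = id := by
    funext c
    simp [Cell.rename]
  rw [this, List.map_id]

/-- Equivalence of diagrams: the congruence with respect to concatenation that is generated by
isotopy and by the removal of dipoles. Two cells `π'`, `π''` form a dipole when the bottom path of
`π'` is the top path of `π''` and the top label of `π'` is the bottom label of `π''`; then the
diagram is isotopic to `Δ₁ ∘ A ∘ A⁻¹ ∘ Δ₂`, where `A` is the atomic diagram that contains `π'`,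
and removing the dipole yields `Δ₁ ∘ Δ₂`. -/
inductive Equivalent : {w w' : List X} → Diagram P w w' → Diagram P w w' → Prop
  | isotopy {w w' : List X} {Δ Δ' : Diagram P w w'} : Isotopic Δ Δ' → Equivalent Δ Δ'
  | dipole (a : Atomic P) : Equivalent ((ofAtomic a).concat (ofAtomicInv a)) (trivial a.top)
  | concat {w₁ w₂ w₃ : List X} {Δ Δ' : Diagram P w₁ w₂} {Γ Γ' : Diagram P w₂ w₃} :
      Equivalent Δ Δ' → Equivalent Γ Γ' → Equivalent (Δ.concat Γ) (Δ'.concat Γ')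
  | symm {w w' : List X} {Δ Δ' : Diagram P w w'} : Equivalent Δ Δ' → Equivalent Δ' Δ
  | trans {w w' : List X} {Δ Δ' Δ'' : Diagram P w w'} :
      Equivalent Δ Δ' → Equivalent Δ' Δ'' → Equivalent Δ Δ''

theorem Equivalent.refl (Δ : Diagram P w w') : Equivalent Δ Δ := .isotopy (.refl Δ)

theorem concat_assoc {w₁ w₂ w₃ w₄ : List X} (A : Diagram P w₁ w₂) (B : Diagram P w₂ w₃)
    (C : Diagram P w₃ w₄) : (A.concat B).concat C = A.concat (B.concat C) :=
  Diagram.ext (List.append_assoc _ _ _)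

theorem trivial_concat (A : Diagram P w w') : (trivial w).concat A = A := rfl

theorem concat_trivial (A : Diagram P w w') : A.concat (trivial w') = A :=
  Diagram.ext (List.append_nil _)

theorem concat_mirror (Δ : Diagram P w w') : Equivalent (Δ.concat Δ.mirror) (trivial w) := by
  obtain ⟨L, h⟩ := Δ
  induction L generalizing w with
  | nil => cases h; exact .refl _
  | cons a L ih =>
    obtain ⟨rfl, h⟩ := h
    have e : concat ⟨a :: L, rfl, h⟩ (mirror ⟨a :: L, rfl, h⟩) =
        (ofAtomic a).concat ((concat ⟨L, h⟩ (mirror ⟨L, h⟩)).concat (ofAtomicInv a)) := by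
      apply Diagram.ext
      simp [concat, mirror, ofAtomic, ofAtomicInv]
    rw [e]
    exact .trans (.concat (.refl _) (.concat (ih h) (.refl _))) (.dipole a)

theorem mirror_mirror (Δ : Diagram P w w') : Δ.mirror.mirror = Δ := by
  apply Diagram.ext
  have : (Atomic.inv ∘ Atomic.inv : Atomic P → Atomic P) = id := rfl
  simp [mirror, this]

theorem mirror_concat (Δ : Diagram P w w') : Equivalent (Δ.mirror.concat Δ) (trivial w') := by
  simpa only [mirror_mirror] using concat_mirror Δ.mirror

theorem Equivalent.mirror {A B : Diagram P w w'} (h : Equivalent A B) :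
    Equivalent A.mirror B.mirror := by
  have h₁ : Equivalent (A.mirror.concat (B.concat B.mirror)) A.mirror := by
    simpa only [concat_trivial] using
      Equivalent.concat (Equivalent.refl A.mirror) (concat_mirror B)
  have h₂ : Equivalent (A.mirror.concat (B.concat B.mirror)) B.mirror := by
    rw [← concat_assoc]
    exact .concat (.trans (.concat (.refl _) h.symm) (mirror_concat A)) (.refl _)
  exact h₁.symm.trans h₂

end Diagram

/-! ### Diagram groups -/

/-- Equivalence of `(w, w)`-diagrams as a setoid. -/
def diagramSetoid (P : Presentation X) (w : List X) : Setoid (Diagram P w w) where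
  r := Diagram.Equivalent
  iseqv := ⟨.refl, .symm, .trans⟩

/-- The diagram group `D(P, w)`: equivalence classes of `(w, w)`-diagrams, multiplied by
concatenation. -/
def DiagramGroup (P : Presentation X) (w : List X) : Type u := Quotient (diagramSetoid P w)

namespace DiagramGroup

variable {w : List X}

/-- The group element represented by a `(w, w)`-diagram. -/
def mk (Δ : Diagram P w w) : DiagramGroup P w := Quotient.mk (diagramSetoid P w) Δ

instance : Group (DiagramGroup P w) where
  mul := Quotient.map₂ Diagram.concat fun _ _ h _ _ k => Diagram.Equivalent.concat h k
  one := mk (Diagram.trivial w)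
  inv := Quotient.map Diagram.mirror fun _ _ h => Diagram.Equivalent.mirror h
  mul_assoc := by
    rintro ⟨A⟩ ⟨B⟩ ⟨C⟩
    exact congrArg mk (Diagram.concat_assoc A B C)
  one_mul := by
    rintro ⟨A⟩
    rfl
  mul_one := by
    rintro ⟨A⟩
    exact congrArg mk (Diagram.concat_trivial A)
  inv_mul_cancel := by
    rintro ⟨A⟩
    exact Quotient.sound (s := diagramSetoid P w) (Diagram.mirror_concat A)

/-- `#(g)`: the number of cells in a diagram with the minimal number of cells representing `g`. -/
noncomputable def numCells (g : DiagramGroup P w) : ℕ :=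
  sInf {n | ∃ Δ : Diagram P w w, mk Δ = g ∧ Δ.numCells = n}

/-- The diagram metric. -/
noncomputable def diagramDist (g h : DiagramGroup P w) : ℕ := numCells (g⁻¹ * h)

end DiagramGroup

/-! ### Word metrics and property B -/

/-- The length of a shortest word over `S ∪ S⁻¹` that represents `g`. -/
noncomputable def wordLength {G : Type*} [Group G] (S : Set G) (g : G) : ℕ :=
  sInf {n | ∃ l : List G, (∀ s ∈ l, s ∈ S ∨ s⁻¹ ∈ S) ∧ l.prod = g ∧ l.length = n}

/-- The word metric. -/
noncomputable def wordDist {G : Type*} [Group G] (S : Set G) (g h : G) : ℕ :=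
  wordLength S (g⁻¹ * h)

/-- The diagram group `D(P, w)` is finitely generated and has property B: its diagram metric is
bi-Lipschitz equivalent to the word metric of a finite generating set (for one such set or for
all of them, as word metrics of finite generating sets are bi-Lipschitz equivalent). -/
def PropertyB (P : Presentation X) (w : List X) : Prop :=
  ∃ S : Set (DiagramGroup P w), S.Finite ∧ Subgroup.closure S = ⊤ ∧
    ∃ c : ℝ, 0 < c ∧ ∀ g h : DiagramGroup P w,
      (DiagramGroup.diagramDist g h : ℝ) ≤ c * wordDist S g h ∧
      (wordDist S g h : ℝ) ≤ c * DiagramGroup.diagramDist g h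

/-! ### Uniform embeddings and Hilbert space compression -/

/-- `f` is a uniform embedding, with control functions `ρ₁` and `ρ₂`, of the space `Γ` with the
distance function `d`. -/
structure IsUniformEmbedding {Γ H : Type*} [NormedAddCommGroup H] (d : Γ → Γ → ℝ≥0)
    (ρ₁ ρ₂ : ℝ≥0 → ℝ≥0) (f : Γ → H) : Prop where
  monotone_lower : Monotone ρ₁
  monotone_upper : Monotone ρ₂
  lower : ∀ x y, ρ₁ (d x y) ≤ ‖f x - f y‖₊
  upper : ∀ x y, ‖f x - f y‖₊ ≤ ρ₂ (d x y)
  tendsto_lower : Filter.Tendsto ρ₁ Filter.atTop Filter.atTop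
  tendsto_upper : Filter.Tendsto ρ₂ Filter.atTop Filter.atTop

/-- The group `G` with the word metric of `S` has a uniform embedding into a separable Hilbert
space with `ρ₁ r = C * r ^ α` for some `C > 0` and with a linear `ρ₂`. -/
def HasCompression {G : Type*} [Group G] (S : Set G) (α : ℝ≥0) : Prop :=
  ∃ (H : Type) (_ : NormedAddCommGroup H) (_ : InnerProductSpace ℝ H) (_ : CompleteSpace H)
    (_ : TopologicalSpace.SeparableSpace H) (f : G → H) (C D : ℝ≥0), 0 < C ∧ 0 < D ∧
    IsUniformEmbedding (fun g h => (wordDist S g h : ℝ≥0))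
      (fun r => C * r ^ (α : ℝ)) (fun r => D * r) f

/-- The Hilbert space compression of `G` with respect to the finite generating set `S`: the
supremum, in `[0, ∞]`, of the exponents `α ≥ 0` as above. (It is `0` when there are no such
exponents, and `∞` when `G` is finite.) -/
noncomputable def hilbertCompression {G : Type*} [Group G] (S : Set G) : ℝ≥0∞ :=
  ⨆ (α : ℝ≥0) (_ : HasCompression S α), (α : ℝ≥0∞)

end DiagramGroups

namespace DiagramGroups

variable {X : Type u} {P : Presentation X}

/-! ### Developed edges

Every edge of a reduced diagram is named by its complete history. -/

/-! The diagram metric is the size of a symmetric difference of finite sets, so it is the square of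
a Hilbert space distance. To obtain the sets, each edge of a reduced diagram is named by its whole
history, and each cell by the names of the edges on its top path together with its labels. These
names do not depend on the order in which the cells are glued. Gluing acts on paths of named edges,
with dipoles cancelled at once (`develop`). The action respects isotopy, because compatibility of a
naming is a condition on each cell separately, and it respects removal of dipoles as long as the
path is `Reduced`. So the named bottom path, and with it the set `F g` of cells in its history,
depends only on the group element `g` (`Diagram.Equivalent.actList_eq`, `Ascending.history_eq`).

One more atomic diagram changes the set of cells by at most one (`Ascending.exists_step`).
Conversely, cells that occur in only one of two reduced diagrams can be removed or added one at a
time, and diagrams with the same cells are equivalent (`Ascending.exists_connecting`). Hence the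
diagram distance of `g` and `h` is the cardinality of `symmDiff (F g) (F h)`.

Sending `g` to the sum of the orthonormal vectors indexed by `F g` turns this distance into a
squared norm. Property B makes it comparable to the word metric, which gives the exponent 1/2 below;
the linear bound above holds since √n ≤ n for natural numbers. -/

/-- An edge named by its history: an edge of the top path, or an edge on the bottom path of the
cell that is determined by its developed top path and its two labels. -/
inductive DevEdge (X : Type u) : Type u where
  | top (i : ℕ)
  | inner (t : List (DevEdge X)) (u v : List X) (j : ℕ)

/-- A cell named by its developed top path and its labels. -/
@[ext] structure DevCell (X : Type u) where
  path : List (DevEdge X)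
  u : List X
  v : List X

namespace DevCell

/-- The `j`-th edge on the bottom path of the cell. -/
def edge (c : DevCell X) (j : ℕ) : DevEdge X := .inner c.path c.u c.v j

/-- The bottom path of the cell. -/
def bot (c : DevCell X) : List (DevEdge X) := (List.range c.v.length).map c.edge

theorem edge_inj {c d : DevCell X} {i j : ℕ} : c.edge i = d.edge j ↔ c = d ∧ i = j := by
  obtain ⟨_, _, _⟩ := c
  obtain ⟨_, _, _⟩ := d
  simp [edge, and_assoc]

@[simp] theorem length_bot (c : DevCell X) : c.bot.length = c.v.length := by simp [bot]

theorem mem_bot {c : DevCell X} {x : DevEdge X} :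
    x ∈ c.bot ↔ ∃ j < c.v.length, c.edge j = x := by simp [bot]

theorem edge_zero_mem_bot {c : DevCell X} (h : c.v ≠ []) : c.edge 0 ∈ c.bot :=
  mem_bot.2 ⟨0, List.length_pos_of_ne_nil h, rfl⟩

/-- A single edge on the bottom path already records its entire cell. -/
theorem bot_inj {c d : DevCell X} (h : c.v ≠ []) (e : c.bot = d.bot) : c = d := by
  have := edge_zero_mem_bot h
  rw [e, mem_bot] at this
  obtain ⟨j, -, hj⟩ := this
  exact (edge_inj.1 hj).1.symm

theorem nodup_bot (c : DevCell X) : c.bot.Nodup :=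
  List.nodup_range.map fun _ _ h => (edge_inj.1 h).2

/-- The top path of the cell is the bottom path of an inverse cell. -/
def Foldable (c : DevCell X) : Prop :=
  ∃ t : List (DevEdge X), t.length = c.v.length ∧ c.path = bot ⟨t, c.v, c.u⟩

end DevCell

open Classical in
/-- Gluing a `(u, v)`-cell below the path `t`, with cancellation of dipoles. -/
noncomputable def develop (t : List (DevEdge X)) (u v : List X) : List (DevEdge X) :=
  if h : DevCell.Foldable ⟨t, u, v⟩ then h.choose else DevCell.bot ⟨t, u, v⟩

theorem develop_of_not_foldable {c : DevCell X} (h : ¬ c.Foldable) :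
    develop c.path c.u c.v = c.bot := dif_neg h

/-- The path chosen in `develop` is the only possible one, because a bottom path determines its
cell. -/
theorem develop_bot {c : DevCell X} (hv : c.v ≠ []) (hp : c.path.length = c.u.length) :
    develop c.bot c.v c.u = c.path := by
  have h : DevCell.Foldable ⟨c.bot, c.v, c.u⟩ := ⟨c.path, hp, rfl⟩
  rw [develop, dif_pos h]
  have := DevCell.bot_inj hv h.choose_spec.2
  rw [DevCell.ext_iff] at this
  exact this.1.symm

@[simp] theorem length_develop (t : List (DevEdge X)) (u v : List X) :
    (develop t u v).length = v.length := by
  unfold develop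
  split_ifs with h
  · exact h.choose_spec.1
  · simp

/-- The bottom path after the atomic diagram `a` has been glued below the path `e`. -/
noncomputable def Atomic.act (a : Atomic P) (e : List (DevEdge X)) : List (DevEdge X) :=
  e.take a.p.length ++ develop ((e.drop a.p.length).take a.u.length) a.u a.v ++
    e.drop (a.p.length + a.u.length)

/-- The bottom path after the atomic diagrams of the list have been glued below the path `e`. -/
noncomputable def actList : List (Atomic P) → List (DevEdge X) → List (DevEdge X)
  | [], e => e
  | a :: L, e => actList L (a.act e)

theorem actList_append (L M : List (Atomic P)) (e : List (DevEdge X)) :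
    actList (L ++ M) e = actList M (actList L e) := by
  induction L generalizing e with
  | nil => rfl
  | cons a L ih => exact ih _

theorem Atomic.u_ne_nil (a : Atomic P) : a.u ≠ [] :=
  a.mem.elim (P.fst_ne_nil _) (P.snd_ne_nil _)

theorem Atomic.v_ne_nil (a : Atomic P) : a.v ≠ [] := a.inv.u_ne_nil

theorem Atomic.act_append (a : Atomic P) {A t B : List (DevEdge X)} (hA : A.length = a.p.length)
    (ht : t.length = a.u.length) : a.act (A ++ t ++ B) = A ++ develop t a.u a.v ++ B := by
  unfold Atomic.act
  rw [← hA, ← ht]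
  simp [List.drop_append]

/-- A list with the length of a concatenation of three words is split accordingly. -/
theorem exists_append₃ {α β : Type*} (e : List α) (p u q : List β)
    (h : e.length = (p ++ u ++ q).length) :
    ∃ A t B, e = A ++ t ++ B ∧ A.length = p.length ∧ t.length = u.length ∧
      B.length = q.length := by
  simp only [List.length_append] at h
  refine ⟨e.take p.length, (e.drop p.length).take u.length, (e.drop p.length).drop u.length,
    ?_, ?_, ?_, ?_⟩
  · rw [List.append_assoc, List.take_append_drop, List.take_append_drop]
  all_goals simp; omega

theorem Atomic.length_act (a : Atomic P) {e : List (DevEdge X)} (h : e.length = a.top.length) :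
    (a.act e).length = a.bot.length := by
  obtain ⟨A, t, B, rfl, hA, ht, hB⟩ := exists_append₃ e a.p a.u a.q h
  rw [a.act_append hA ht]
  simp [Atomic.bot, hA, hB]

theorem length_actList {L : List (Atomic P)} {w w' : List X} (hL : Composable L w w')
    {e : List (DevEdge X)} (h : e.length = w.length) : (actList L e).length = w'.length := by
  induction L generalizing w e with
  | nil => cases hL; exact h
  | cons a L ih =>
    obtain ⟨rfl, hL⟩ := hL
    exact ih hL (a.length_act h)

/-! ### Cells in the history of an edge -/

/-- The cell `c` occurs in the history of an edge. -/
inductive Anc (c : DevCell X) : DevEdge X → Prop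
  | self (j : ℕ) : Anc c (c.edge j)
  | step {t : List (DevEdge X)} {x : DevEdge X} (u v : List X) (j : ℕ) :
      x ∈ t → Anc c x → Anc c (.inner t u v j)

theorem Anc.trans {c d : DevCell X} {x y : DevEdge X} (hy : y ∈ d.path) (hc : Anc c y)
    (hd : Anc d x) : Anc c x := by
  induction hd with
  | self j => exact .step _ _ _ hy hc
  | step u v j hx _ ih => exact .step _ _ _ hx ih

theorem not_anc_top {c : DevCell X} {i : ℕ} : ¬ Anc c (.top i) := nofun

theorem anc_edge {c d : DevCell X} {j : ℕ} :
    Anc c (d.edge j) ↔ c = d ∨ ∃ x ∈ d.path, Anc c x := by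
  constructor
  · intro h
    generalize hy : d.edge j = y at h
    cases h with
    | self i => exact .inl (DevCell.edge_inj.1 hy).1.symm
    | step u v i hx h =>
      obtain ⟨rfl, -⟩ := DevEdge.inner.inj hy
      exact .inr ⟨_, hx, h⟩
  · rintro (rfl | ⟨x, hx, h⟩)
    · exact .self j
    · exact .step _ _ _ hx h

/-- The cells in the history of a path. -/
def history (e : List (DevEdge X)) : Set (DevCell X) := {c | ∃ x ∈ e, Anc c x}

theorem history_append (e e' : List (DevEdge X)) :
    history (e ++ e') = history e ∪ history e' := by
  ext c
  simp [history, or_and_right, exists_or]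

theorem history_bot {c : DevCell X} (h : c.v ≠ []) : history c.bot = insert c (history c.path) := by
  ext d
  simp only [history, Set.mem_ofPred_eq, Set.mem_insert_iff, DevCell.mem_bot]
  constructor
  · rintro ⟨_, ⟨j, -, rfl⟩, hd⟩
    exact anc_edge.1 hd
  · intro hd
    exact ⟨c.edge 0, ⟨0, List.length_pos_of_ne_nil h, rfl⟩, anc_edge.2 hd⟩

theorem history_top (n : ℕ) : history ((List.range n).map (DevEdge.top (X := X))) = ∅ := by
  ext c
  simp [history, not_anc_top]

/-- No dipoles have been created in the history of the path. -/
def Reduced (e : List (DevEdge X)) : Prop := ∀ c ∈ history e, ¬ c.Foldable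

theorem reduced_top (n : ℕ) : Reduced ((List.range n).map (DevEdge.top (X := X))) := by
  simp [Reduced, history_top]

/-- Cancelling a dipole only removes a cell from the history; otherwise the one new cell is not
foldable by the case distinction in `develop`. -/
theorem Reduced.act {a : Atomic P} {e : List (DevEdge X)} (he : Reduced e)
    (h : e.length = a.top.length) : Reduced (a.act e) := by
  obtain ⟨A, t, B, rfl, hA, ht, hB⟩ := exists_append₃ e a.p a.u a.q h
  rw [a.act_append hA ht]
  intro c hc
  rw [history_append, history_append] at hc
  by_cases hf : DevCell.Foldable ⟨t, a.u, a.v⟩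
  · obtain ⟨s, hs, hst⟩ := id hf
    replace hst : t = DevCell.bot ⟨s, a.v, a.u⟩ := hst
    subst hst
    rw [develop_bot (c := ⟨s, a.v, a.u⟩) a.u_ne_nil hs] at hc
    refine he c ?_
    rw [history_append, history_append, history_bot (c := ⟨s, a.v, a.u⟩) a.u_ne_nil]
    rcases hc with (hc | hc) | hc
    · exact .inl (.inl hc)
    · exact .inl (.inr (.inr hc))
    · exact .inr hc
  · rw [develop_of_not_foldable (c := ⟨t, a.u, a.v⟩) hf,
      history_bot (c := ⟨t, a.u, a.v⟩) a.v_ne_nil] at hc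
    simp only [Reduced, history_append] at he
    rcases hc with (hc | rfl | hc) | hc
    · exact he c (.inl (.inl hc))
    · exact hf
    · exact he c (.inl (.inr hc))
    · exact he c (.inr hc)

theorem Reduced.actList {L : List (Atomic P)} {w w' : List X} (hL : Composable L w w')
    {e : List (DevEdge X)} (he : Reduced e) (h : e.length = w.length) :
    Reduced (actList L e) := by
  induction L generalizing w e with
  | nil => exact he
  | cons a L ih =>
    obtain ⟨rfl, hL⟩ := hL
    exact ih hL (he.act h) (a.length_act h)

/-- This is where reducedness matters: if gluing `a` cancels a cell, gluing `a.inv` must restore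
that cell instead of folding further, and it does so because a cell in the history of `e` is not
foldable. -/
theorem act_inv_act (a : Atomic P) {e : List (DevEdge X)} (he : Reduced e)
    (h : e.length = a.top.length) : a.inv.act (a.act e) = e := by
  obtain ⟨A, t, B, rfl, hA, ht, hB⟩ := exists_append₃ e a.p a.u a.q h
  rw [a.act_append hA ht, a.inv.act_append (by exact hA) (by simp [Atomic.inv])]
  congr 2
  change develop (develop t a.u a.v) a.v a.u = t
  by_cases hf : DevCell.Foldable ⟨t, a.u, a.v⟩
  · obtain ⟨s, hs, hst⟩ := id hf
    replace hst : t = DevCell.bot ⟨s, a.v, a.u⟩ := hst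
    subst hst
    rw [develop_bot (c := ⟨s, a.v, a.u⟩) a.u_ne_nil hs]
    refine develop_of_not_foldable (c := ⟨s, a.v, a.u⟩) (he _ ?_)
    rw [history_append, history_append, history_bot (c := ⟨s, a.v, a.u⟩) a.u_ne_nil]
    exact .inl (.inr (.inl rfl))
  · rw [develop_of_not_foldable (c := ⟨t, a.u, a.v⟩) hf]
    exact develop_bot (c := ⟨t, a.u, a.v⟩) a.v_ne_nil ht

/-! ### Invariance under isotopy and removal of dipoles -/

/-- An assignment of developed edges to the edges of a diagram that is compatible with a cell. -/
def Cell.Compatible (φ : Edge → DevEdge X) (c : Cell X) : Prop :=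
  c.botPath.map φ = develop (c.topPath.map φ) c.topLabel c.botLabel

theorem map_botFrom {φ : Edge → DevEdge X} {k : ℕ} {e : List Edge} {L : List (Atomic P)}
    (h : ∀ c ∈ cellsFrom k e L, c.Compatible φ) :
    (botFrom k e L).map φ = actList L (e.map φ) := by
  induction L generalizing k e with
  | nil => rfl
  | cons a L ih =>
    rw [botFrom, ih fun c hc => h c (List.mem_cons_of_mem _ hc), actList]
    congr 1
    have h₀ := h _ List.mem_cons_self
    simp only [Cell.Compatible, attachedCell] at h₀
    simp only [nextPath, attachedCell, Atomic.act, List.map_append, h₀, List.map_take,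
      List.map_drop]

/-- The edge does not lie on the bottom path of a cell numbered `k` or more. -/
def Edge.Below (k : ℕ) : Edge → Prop
  | .top _ => True
  | .inner i _ => i < k

/-- The bottom edges of each cell are new when the cell is glued, so their values can be prescribed
freely, cell by cell. -/
theorem exists_compatible (L : List (Atomic P)) (k : ℕ) (e : List Edge)
    (he : ∀ x ∈ e, x.Below k) (φ : Edge → DevEdge X) :
    ∃ ψ : Edge → DevEdge X, (∀ x, x.Below k → ψ x = φ x) ∧
      ∀ c ∈ cellsFrom k e L, c.Compatible ψ := by
  induction L generalizing k e φ with
  | nil => exact ⟨φ, fun _ _ => rfl, nofun⟩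
  | cons a L ih =>
    let d := develop (((e.drop a.p.length).take a.u.length).map φ) a.u a.v
    have hd : d.length = a.v.length := length_develop _ _ _
    let φ' : Edge → DevEdge X := fun x => match x with
      | .top i => φ (.top i)
      | .inner i j => if i = k then d.getD j (.top 0) else φ (.inner i j)
    have hφ : ∀ x, Edge.Below k x → φ' x = φ x := by
      rintro (i | ⟨i, j⟩) hx
      · rfl
      · exact if_neg (Nat.ne_of_lt hx)
    have hmono : ∀ x, Edge.Below k x → Edge.Below (k + 1) x := by
      rintro (i | ⟨i, j⟩) hx
      · trivial
      · exact Nat.lt_succ_of_lt hx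
    obtain ⟨ψ, hψ, hc⟩ := ih (k + 1) (nextPath k e a) (by
      intro x hx
      simp only [nextPath, attachedCell, List.mem_append, List.mem_map] at hx
      rcases hx with (hx | ⟨j, -, rfl⟩) | hx
      · exact hmono _ (he _ (List.mem_of_mem_take hx))
      · exact Nat.lt_succ_self k
      · exact hmono _ (he _ (List.mem_of_mem_drop hx))) φ'
    have hψφ : ∀ x, Edge.Below k x → ψ x = φ x := fun x hx => (hψ x (hmono x hx)).trans (hφ x hx)
    refine ⟨ψ, hψφ, ?_⟩
    intro c hc'
    rcases List.mem_cons.1 hc' with rfl | hc'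
    · simp only [Cell.Compatible, attachedCell]
      have h₁ : ((e.drop a.p.length).take a.u.length).map ψ =
          ((e.drop a.p.length).take a.u.length).map φ :=
        List.map_congr_left fun x hx =>
          hψφ x (he x (List.mem_of_mem_drop (List.mem_of_mem_take hx)))
      rw [h₁]
      change _ = d
      refine List.ext_getElem (by simp [hd]) fun j h₂ h₃ => ?_
      simp only [List.getElem_map, List.getElem_range]
      rw [hψ (.inner k j) (Nat.lt_succ_self k)]
      simp [φ', h₃]
    · exact hc c hc'

/-- A naming compatible with all cells of `Δ'` pulls back along the edge bijection to one compatible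
with all cells of `Δ`; the order of the cells plays no role. -/
theorem Diagram.Isotopic.actList_eq {w w' : List X} {Δ Δ' : Diagram P w w'} (h : Isotopic Δ Δ')
    {e : List (DevEdge X)} (he : e.length = w.length) :
    actList Δ.atoms e = actList Δ'.atoms e := by
  obtain ⟨τ, h₁, h₂, h₃⟩ := h
  -- Only the values on the edges of the top path matter; both default values are arbitrary.
  let φ : Edge → DevEdge X := fun x => match x with
    | .top i => e.getD i (.top 0)
    | .inner _ _ => .top 0
  obtain ⟨ψ, hψ, hc⟩ := exists_compatible Δ'.atoms 0 Δ'.topPath (by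
    intro x hx
    simp only [topPath, List.mem_map] at hx
    obtain ⟨i, -, rfl⟩ := hx
    trivial) φ
  have htop : Δ'.topPath.map ψ = e := by
    refine List.ext_getElem (by simp [topPath, he]) fun j h₂ h₃ => ?_
    simp only [topPath, List.getElem_map, List.getElem_range]
    rw [hψ (.top j) True.intro]
    simp [φ, h₃]
  have e₁ := map_botFrom hc
  have e₂ := map_botFrom (φ := ψ ∘ τ) (k := 0) (e := Δ.topPath) (L := Δ.atoms) (by
    intro c hc'
    have := hc _ (h₃.mem_iff.1 (List.mem_map_of_mem hc'))
    simpa [Cell.Compatible, Cell.rename] using this)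
  rw [← List.map_map, ← List.map_map, h₁, htop] at e₂
  rw [htop] at e₁
  rw [← e₁, ← e₂]
  exact congrArg _ h₂

theorem Diagram.Equivalent.actList_eq {w w' : List X} {Δ Δ' : Diagram P w w'}
    (h : Equivalent Δ Δ') {e : List (DevEdge X)} (he : e.length = w.length) (hr : Reduced e) :
    actList Δ.atoms e = actList Δ'.atoms e := by
  induction h generalizing e with
  | isotopy h => exact h.actList_eq he
  | dipole a => exact act_inv_act a hr he
  | @concat _ _ _ Δ Δ' Γ Γ' _ _ ih₁ ih₂ =>
    change actList (Δ.atoms ++ Γ.atoms) e = actList (Δ'.atoms ++ Γ'.atoms) e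
    rw [actList_append, actList_append, ← ih₁ he hr]
    exact ih₂ (length_actList Δ.composable he) (hr.actList Δ.composable he)
  | symm _ ih => exact (ih he hr).symm
  | trans _ _ ih₁ ih₂ => exact (ih₁ he hr).trans (ih₂ he hr)

/-! ### Equivalence of concatenations of atomic diagrams -/

/-- Both lists present `(w, w')`-diagrams, and these are equivalent. -/
def EqList (w w' : List X) (L L' : List (Atomic P)) : Prop :=
  ∃ (h : Composable L w w') (h' : Composable L' w w'),
    Diagram.Equivalent (⟨L, h⟩ : Diagram P w w') ⟨L', h'⟩

namespace EqList

variable {w w' w'' : List X} {L L' L'' M M' : List (Atomic P)}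

theorem refl (h : Composable L w w') : EqList w w' L L := ⟨h, h, .refl _⟩

theorem symm (h : EqList w w' L L') : EqList w w' L' L := by
  obtain ⟨h₁, h₂, h⟩ := h
  exact ⟨h₂, h₁, h.symm⟩

theorem trans (h : EqList w w' L L') (k : EqList w w' L' L'') : EqList w w' L L'' := by
  obtain ⟨h₁, _, h⟩ := h
  obtain ⟨_, k₂, k⟩ := k
  exact ⟨h₁, k₂, h.trans k⟩

theorem append (h : EqList w w' L L') (k : EqList w' w'' M M') :
    EqList w w'' (L ++ M) (L' ++ M') := by
  obtain ⟨h₁, h₂, h⟩ := h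
  obtain ⟨k₁, k₂, k⟩ := k
  exact ⟨h₁.append k₁, h₂.append k₂, h.concat k⟩

theorem dipole (a : Atomic P) : EqList a.top a.top [a, a.inv] [] :=
  ⟨⟨rfl, rfl, rfl⟩, rfl, .dipole a⟩

theorem actList_eq (h : EqList w w' L L') {e : List (DevEdge X)} (he : e.length = w.length)
    (hr : Reduced e) : actList L e = actList L' e := by
  obtain ⟨_, _, h⟩ := h
  exact h.actList_eq he hr

end EqList

/-! ### Interchanging cells in disjoint positions. -/

theorem attachedCell_append (k : ℕ) (a : Atomic P) {A t B : List Edge}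
    (hA : A.length = a.p.length) (ht : t.length = a.u.length) :
    attachedCell k (A ++ t ++ B) a =
      ⟨t, a.u, (List.range a.v.length).map (Edge.inner k), a.v⟩ := by
  unfold attachedCell
  rw [← hA, ← ht]
  simp

theorem nextPath_append (k : ℕ) (a : Atomic P) {A t B : List Edge}
    (hA : A.length = a.p.length) (ht : t.length = a.u.length) :
    nextPath k (A ++ t ++ B) a =
      A ++ (List.range a.v.length).map (Edge.inner k) ++ B := by
  rw [nextPath, attachedCell_append k a hA ht, ← hA, ← ht]
  simp [List.drop_append]

/-- Exchange the bottom edges of the first two cells. -/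
def Edge.swap : Edge → Edge
  | .inner 0 j => .inner 1 j
  | .inner 1 j => .inner 0 j
  | e => e

theorem Edge.swap_involutive : Function.Involutive Edge.swap := by
  rintro (i | ⟨_ | _ | k, j⟩) <;> rfl

/-- Atomic diagrams with disjoint cells commute. -/
theorem EqList.swap (p u v m u' v' q : List X) (h : (u, v) ∈ P.rels ∨ (v, u) ∈ P.rels)
    (h' : (u', v') ∈ P.rels ∨ (v', u') ∈ P.rels) :
    EqList (p ++ u ++ (m ++ u' ++ q)) (p ++ v ++ (m ++ v' ++ q))
      [(⟨p, u, v, m ++ u' ++ q, h⟩ : Atomic P), ⟨p ++ v ++ m, u', v', q, h'⟩]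
      [⟨p ++ u ++ m, u', v', q, h'⟩, ⟨p, u, v, m ++ v' ++ q, h⟩] := by
  refine ⟨⟨rfl, ?_, ?_⟩, ⟨?_, ?_, rfl⟩, .isotopy ⟨Edge.swap_involutive.toPerm, ?_, ?_⟩⟩
  · simp [Atomic.top, Atomic.bot]
  · simp [Atomic.bot, Composable]
  · simp [Atomic.top]
  · simp [Atomic.top, Atomic.bot]
  · simp [Diagram.topPath, Edge.swap]
  obtain ⟨A, t, B', hE, hA, ht, hB'⟩ := exists_append₃
    ((List.range (p ++ u ++ (m ++ u' ++ q)).length).map Edge.top) p u (m ++ u' ++ q) (by simp)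
  obtain ⟨M, t', B, rfl, hM, ht', hB⟩ := exists_append₃ B' m u' q hB'
  have fix : ∀ l : List Edge, (∀ x ∈ l, x ∈ A ++ t ++ (M ++ t' ++ B)) → l.map Edge.swap = l := by
    intro l hl
    refine (List.map_congr_left fun x hx => ?_).trans (List.map_id l)
    have := hl x hx
    rw [← hE, List.mem_map] at this
    obtain ⟨i, -, rfl⟩ := this
    rfl
  have fA := fix A (by simp +contextual)
  have ft := fix t (by simp +contextual)
  have fM := fix M (by simp +contextual)
  have ft' := fix t' (by simp +contextual)
  have fB := fix B (by simp +contextual)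
  let V (k : ℕ) (v : List X) : List Edge := (List.range v.length).map (Edge.inner k)
  have n₁ (k : ℕ) (B : List Edge) (q : List X) :
      nextPath k (A ++ t ++ B) (⟨p, u, v, q, h⟩ : Atomic P) = A ++ V k v ++ B :=
    nextPath_append k (⟨p, u, v, q, h⟩ : Atomic P) hA ht
  have n₂ (k : ℕ) (s : List Edge) (r : List X) (hs : s.length = r.length) :
      nextPath k (A ++ s ++ M ++ t' ++ B) (⟨p ++ r ++ m, u', v', q, h'⟩ : Atomic P) =
        A ++ s ++ M ++ V k v' ++ B :=
    nextPath_append k (⟨p ++ r ++ m, u', v', q, h'⟩ : Atomic P) (by simp [hA, hM, hs]) ht'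
  have a₁ (k : ℕ) (B : List Edge) (q : List X) :
      attachedCell k (A ++ t ++ B) (⟨p, u, v, q, h⟩ : Atomic P) = ⟨t, u, V k v, v⟩ :=
    attachedCell_append k (⟨p, u, v, q, h⟩ : Atomic P) hA ht
  have a₂ (k : ℕ) (s : List Edge) (r : List X) (hs : s.length = r.length) :
      attachedCell k (A ++ s ++ M ++ t' ++ B) (⟨p ++ r ++ m, u', v', q, h'⟩ : Atomic P) =
        ⟨t', u', V k v', v'⟩ :=
    attachedCell_append k (⟨p ++ r ++ m, u', v', q, h'⟩ : Atomic P) (by simp [hA, hM, hs]) ht'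
  have e₁ (s s' : List Edge) : A ++ s ++ (M ++ s' ++ B) = A ++ s ++ M ++ s' ++ B := by simp
  have hV : (V 0 v).length = v.length := by simp [V]
  have s₀ (r : List X) : (V 0 r).map Edge.swap = V 1 r := by simp [V, Edge.swap]
  have s₁ (r : List X) : (V 1 r).map Edge.swap = V 0 r := by simp [V, Edge.swap]
  refine ⟨?_, ?_⟩
  · simp only [Diagram.botPath, Diagram.topPath, hE, botFrom, Nat.zero_add,
      Function.Involutive.coe_toPerm]
    rw [n₁, e₁ (V 0 v), n₂ _ _ _ hV, e₁ t, n₂ _ _ _ ht, ← e₁ t, n₁]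
    simp [fA, fM, fB, s₀, s₁]
  · simp only [Diagram.cells, Diagram.topPath, hE, cellsFrom, Nat.zero_add,
      Function.Involutive.coe_toPerm]
    rw [n₁, a₁, e₁, e₁, a₂ _ _ _ hV, a₂ _ _ _ ht, n₂ _ _ _ ht, ← e₁ t, a₁]
    simp [Cell.rename, ft, ft', s₀, s₁, List.Perm.swap]

/-- In a path without repeated edges the first edge of a nonempty segment fixes its position. -/
theorem append_segment_inj {α : Type*} {A t B A' B' : List α} (hn : (A ++ t ++ B).Nodup)
    (ht : t ≠ []) (h : A ++ t ++ B = A' ++ t ++ B') : A = A' ∧ B = B' := by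
  cases t with
  | nil => exact absurd rfl ht
  | cons x t =>
    have hn' := h ▸ hn
    simp only [List.append_assoc, List.cons_append] at h hn hn'
    rw [List.nodup_middle, List.nodup_cons] at hn hn'
    simp only [List.mem_append, not_or] at hn hn'
    obtain ⟨rfl, -, h⟩ := (List.append_cons_inj_of_notMem hn'.1.1
      (by simpa using hn'.1.2)).1 h.symm
    exact ⟨rfl, (List.append_cancel_left h).symm⟩

theorem disjoint_segments {α : Type*} {A s B A' t B' : List α} (hs : s ≠ []) (ht : t ≠ [])
    (hst : ∀ x ∈ s, x ∉ t) (h : A ++ s ++ B = A' ++ t ++ B') :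
    (∃ M, A' = A ++ s ++ M ∧ B = M ++ t ++ B') ∨ (∃ M, A = A' ++ t ++ M ∧ B' = M ++ s ++ B) := by
  simp only [List.append_assoc] at h ⊢
  have key : ∀ {s t B B' a' : List α}, s ≠ [] → t ≠ [] → (∀ x ∈ s, x ∉ t) →
      s ++ B = a' ++ (t ++ B') → ∃ M, a' = s ++ M ∧ B = M ++ (t ++ B') := by
    intro s t B B' a' hs ht hst h
    rcases List.append_eq_append_iff.1 h with ⟨m, h₁, h₂⟩ | ⟨m, h₁, h₂⟩
    · exact ⟨m, h₁, h₂⟩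
    · cases m with
      | nil => exact ⟨[], by simpa using h₁.symm, by simpa using h₂.symm⟩
      | cons x m =>
        cases t with
        | nil => exact absurd rfl ht
        | cons y t =>
          obtain ⟨rfl, -⟩ := List.cons.inj h₂
          exact absurd List.mem_cons_self (hst y (by simp [h₁]))
  rcases List.append_eq_append_iff.1 h with ⟨a', rfl, h₂⟩ | ⟨a', rfl, h₂⟩
  · obtain ⟨M, rfl, rfl⟩ := key hs ht hst h₂
    exact .inl ⟨M, rfl, rfl⟩
  · obtain ⟨M, rfl, rfl⟩ := key ht hs (fun x hx hx' => hst x hx' hx) h₂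
    exact .inr ⟨M, rfl, rfl⟩

/-! ### Ascending concatenations -/

/-- Gluing the atomic diagram `a` below the path `A ++ c.path ++ B` adds the cell `c`. -/
structure Atomic.Adds (a : Atomic P) (A B : List (DevEdge X)) (c : DevCell X) : Prop where
  length_left : A.length = a.p.length
  length_path : c.path.length = a.u.length
  length_right : B.length = a.q.length
  u_eq : c.u = a.u
  v_eq : c.v = a.v
  not_foldable : ¬ c.Foldable

namespace Atomic.Adds

variable {a b : Atomic P} {A B A' B' : List (DevEdge X)} {c d : DevCell X}

theorem v_ne_nil (h : a.Adds A B c) : c.v ≠ [] := h.v_eq ▸ a.v_ne_nil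

theorem path_ne_nil (h : a.Adds A B c) : c.path ≠ [] := by
  rw [← List.length_pos_iff, h.length_path]
  exact List.length_pos_of_ne_nil a.u_ne_nil

theorem bot_ne_nil (h : a.Adds A B c) : c.bot ≠ [] :=
  List.ne_nil_of_mem (DevCell.edge_zero_mem_bot h.v_ne_nil)

theorem act_eq (h : a.Adds A B c) : a.act (A ++ c.path ++ B) = A ++ c.bot ++ B := by
  rw [a.act_append h.length_left h.length_path, ← develop_of_not_foldable h.not_foldable, h.u_eq,
    h.v_eq]

/-- As no bottom edge of `c` lies on the top path of `d`, the two segments of the intermediate path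
are disjoint; `d` sits to the right or to the left of `c`, and the gluings can be interchanged. -/
theorem commute (hb : b.Adds A B c) (ha : a.Adds A' B' d) (hab : a.top = b.bot)
    (he : A ++ c.bot ++ B = A' ++ d.path ++ B') (hcd : ∀ j, c.edge j ∉ d.path) :
    ∃ (a' b' : Atomic P) (A₁ B₁ A₂ B₂ : List (DevEdge X)),
      a'.Adds A₁ B₁ d ∧ b'.Adds A₂ B₂ c ∧ A ++ c.path ++ B = A₁ ++ d.path ++ B₁ ∧
      A₁ ++ d.bot ++ B₁ = A₂ ++ c.path ++ B₂ ∧ A₂ ++ c.bot ++ B₂ = A' ++ d.bot ++ B' ∧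
      a'.top = b.top ∧ b'.top = a'.bot ∧ b'.bot = a.bot ∧
      EqList b.top a.bot [b, a] [a', b'] := by
  have hdisj : ∀ x ∈ c.bot, x ∉ d.path := by
    intro x hx
    obtain ⟨j, -, rfl⟩ := DevCell.mem_bot.1 hx
    exact hcd j
  obtain ⟨p, u, v, q, h⟩ := b
  obtain ⟨p', u', v', q', h'⟩ := a
  obtain ⟨lA, lp, lB, hu, hv, hf⟩ := hb
  obtain ⟨lA', lp', lB', hu', hv', hf'⟩ := ha
  have hc0 : c.bot ≠ [] := List.ne_nil_of_mem (DevCell.edge_zero_mem_bot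
    (hv ▸ Atomic.v_ne_nil ⟨p, u, v, q, h⟩))
  have hd0 : d.path ≠ [] := by
    rw [← List.length_pos_iff, lp']
    exact List.length_pos_of_ne_nil (Atomic.u_ne_nil ⟨p', u', v', q', h'⟩)
  simp only [Atomic.top, Atomic.bot] at *
  rcases disjoint_segments hc0 hd0 hdisj he with ⟨M, rfl, rfl⟩ | ⟨M, rfl, rfl⟩
  · obtain ⟨m, rfl⟩ : p ++ v <+: p' := by
      refine List.prefix_of_prefix_length_le (List.prefix_append _ q) ?_ ?_
      · rw [← hab, List.append_assoc]
        exact List.prefix_append _ _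
      · simp at lA'
        simp [← lA', lA, hv]
    obtain rfl : m ++ u' ++ q' = q := by simpa using hab
    have hM : M.length = m.length := by
      simp only [List.length_append, DevCell.length_bot, hv] at lA'
      omega
    refine ⟨⟨p ++ u ++ m, u', v', q', h'⟩, ⟨p, u, v, m ++ v' ++ q', h⟩, A ++ c.path ++ M, B',
      A, M ++ d.bot ++ B', ⟨?_, lp', lB', hu', hv', hf'⟩, ⟨lA, lp, ?_, hu, hv, hf⟩,
      ?_, ?_, ?_, ?_, ?_, ?_, ?_⟩
    · simp [lA, lp, hM]
    · simp [hM, hv', lB']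
    all_goals try simp
    simpa using EqList.swap p u v m u' v' q' h h'
  · obtain ⟨m, rfl⟩ : p' ++ u' <+: p := by
      refine List.prefix_of_prefix_length_le (List.prefix_append _ q') ?_ ?_
      · rw [hab, List.append_assoc]
        exact List.prefix_append _ _
      · simp at lA
        simp [← lA, lA', lp']
    obtain rfl : q' = m ++ v ++ q := by simpa using hab
    have hM : M.length = m.length := by
      simp only [List.length_append, lp'] at lA
      omega
    refine ⟨⟨p', u', v', m ++ u ++ q, h'⟩, ⟨p' ++ v' ++ m, u, v, q, h⟩, A', M ++ c.path ++ B,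
      A' ++ d.bot ++ M, B, ⟨lA', lp', ?_, hu', hv', hf'⟩, ⟨?_, lp, lB, hu, hv, hf⟩,
      ?_, ?_, ?_, ?_, ?_, ?_, ?_⟩
    · simp [hM, lp, lB]
    · simp [hM, hv', lA']
    all_goals try simp
    simpa using (EqList.swap p' u' v' m u v q h' h).symm

end Atomic.Adds

/-- The list presents a `(w, w')`-diagram without dipoles: each atomic diagram adds a new cell.
The developed bottom path is `e`, and `H` lists the cells, the last one first. -/
inductive Ascending (w : List X) :
    List (Atomic P) → List X → List (DevEdge X) → List (DevCell X) → Prop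
  | nil : Ascending w [] w ((List.range w.length).map .top) []
  | snoc {L : List (Atomic P)} {a : Atomic P} {e A B : List (DevEdge X)} {c : DevCell X}
      {H : List (DevCell X)} : Ascending w L a.top e H → e = A ++ c.path ++ B → a.Adds A B c →
      Ascending w (L ++ [a]) a.bot (A ++ c.bot ++ B) (c :: H)

namespace Ascending

variable {w w' : List X} {L : List (Atomic P)} {e : List (DevEdge X)} {H : List (DevCell X)}

theorem composable (h : Ascending w L w' e H) : Composable L w w' := by
  induction h with
  | nil => rfl
  | snoc _ _ _ ih => exact ih.append ⟨rfl, rfl⟩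

theorem actList_eq (h : Ascending w L w' e H) : actList L ((List.range w.length).map .top) = e := by
  induction h with
  | nil => rfl
  | snoc _ he ha ih => rw [actList_append, ih, he]; exact ha.act_eq

theorem length_eq (h : Ascending w L w' e H) : e.length = w'.length := by
  rw [← h.actList_eq]
  exact length_actList h.composable (by simp)

/-- Edges covered by a new cell leave the path, but their history survives in that of the cell. So
the bottom path alone remembers all cells. -/
theorem history_eq (h : Ascending w L w' e H) : history e = {c | c ∈ H} := by
  induction h with
  | nil => simp [history_top]
  | snoc _ he ha ih =>
    subst he
    rw [history_append, history_append] at ih ⊢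
    rw [history_bot ha.v_ne_nil]
    ext d
    rw [Set.ext_iff] at ih
    have := ih d
    simp only [Set.mem_union, Set.mem_insert_iff, Set.mem_ofPred_eq, List.mem_cons] at this ⊢
    tauto

theorem mem_of_edge_mem_path (h : Ascending w L w' e H) {c d : DevCell X} (hd : d ∈ H) {j : ℕ}
    (hj : c.edge j ∈ d.path) : c ∈ H := by
  have he := h.history_eq
  rw [Set.ext_iff] at he
  obtain ⟨x, hx, hd⟩ := (he d).2 hd
  exact (he c).1 ⟨x, hx, .trans hj (.self j) hd⟩

/-- Every edge lies on the bottom path or on the top path of a cell, and also on the top path or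
on the bottom path of a cell. -/
theorem perm (h : Ascending w L w' e H) : (e ++ H.flatMap DevCell.path).Perm
    ((List.range w.length).map .top ++ H.flatMap DevCell.bot) := by
  induction h with
  | nil => simp
  | snoc _ he ha ih =>
    subst he
    rw [← Multiset.coe_eq_coe] at ih ⊢
    simp only [List.flatMap_cons, ← Multiset.coe_add] at ih ⊢
    rw [add_left_comm (Multiset.ofList _) (Multiset.ofList (DevCell.bot _)), ← ih]
    abel

/-- By `perm` it suffices to look at bottom paths, and these are disjoint for distinct cells since
an edge names its cell. A repeated cell would have its top path both on the current bottom path and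
among the edges already covered. -/
theorem nodup (h : Ascending w L w' e H) :
    H.Nodup ∧ (e ++ H.flatMap DevCell.path).Nodup := by
  have key : ∀ H : List (DevCell X), H.Nodup →
      ((List.range w.length).map DevEdge.top ++ H.flatMap DevCell.bot).Nodup := by
    intro H hH
    rw [List.nodup_append', List.nodup_flatMap]
    refine ⟨List.nodup_range.map fun _ _ h => by simpa using h,
      ⟨fun c _ => c.nodup_bot, hH.imp ?_⟩, ?_⟩
    · intro c d hcd x hc hd
      obtain ⟨i, -, rfl⟩ := DevCell.mem_bot.1 hc
      obtain ⟨j, -, hj⟩ := DevCell.mem_bot.1 hd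
      exact hcd (DevCell.edge_inj.1 hj).1.symm
    · intro x hx hx'
      obtain ⟨i, -, rfl⟩ := List.mem_map.1 hx
      obtain ⟨c, -, hc⟩ := List.mem_flatMap.1 hx'
      obtain ⟨j, -, hj⟩ := DevCell.mem_bot.1 hc
      cases hj
  suffices hH : H.Nodup from ⟨hH, h.perm.nodup_iff.2 (key H hH)⟩
  induction h with
  | nil => simp
  | @snoc L a e A B c H h he ha ih =>
    refine List.nodup_cons.2 ⟨fun hc => ?_, ih⟩
    have := h.perm.nodup_iff.2 (key H ih)
    rw [List.nodup_append'] at this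
    obtain ⟨x, hx⟩ := List.exists_mem_of_ne_nil _ ha.path_ne_nil
    exact this.2.2 (by simp [he, hx]) (List.mem_flatMap.2 ⟨c, hc, hx⟩)

/-- Outside a set of cells that contains all predecessors of its elements there is a cell without
successors. -/
theorem exists_maximal (h : Ascending w L w' e H) {Q : Set (DevCell X)}
    (hQ : ∀ d ∈ Q, ∀ (c : DevCell X) (j : ℕ), c.edge j ∈ d.path → c ∈ Q)
    (hH : ∃ c ∈ H, c ∉ Q) :
    ∃ c ∈ H, c ∉ Q ∧ ∀ d ∈ H, ∀ j, c.edge j ∉ d.path := by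
  induction h with
  | nil => simp at hH
  | @snoc L a e A B d H h he ha ih =>
    have hd := (List.nodup_cons.1 (h.snoc he ha).nodup.1).1
    -- If the last cell `d` lies outside `Q`, it is maximal itself. Otherwise it cannot be a
    -- successor of a cell outside `Q`, as `Q` contains all predecessors of `d`.
    by_cases hdQ : d ∈ Q
    · obtain ⟨c, hc, hcQ, hmax⟩ := ih (by
        obtain ⟨c, hc, hcQ⟩ := hH
        rcases List.mem_cons.1 hc with rfl | hc
        · exact absurd hdQ hcQ
        · exact ⟨c, hc, hcQ⟩)
      refine ⟨c, List.mem_cons_of_mem _ hc, hcQ, fun d' hd' j hj => ?_⟩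
      rcases List.mem_cons.1 hd' with rfl | hd'
      · exact hcQ (hQ _ hdQ _ _ hj)
      · exact hmax d' hd' j hj
    · refine ⟨d, List.mem_cons_self, hdQ, fun d' hd' j hj => hd ?_⟩
      rcases List.mem_cons.1 hd' with rfl | hd'
      · have he' := h.history_eq
        rw [Set.ext_iff] at he'
        exact (he' d').1 ⟨_, by simp [he, hj], .self j⟩
      · exact h.mem_of_edge_mem_path hd' hj

/-- A cell without successors can be glued last. -/
theorem exists_snoc (h : Ascending w L w' e H) {c : DevCell X} (hc : c ∈ H)
    (hmax : ∀ d ∈ H, ∀ j, c.edge j ∉ d.path) :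
    ∃ (L₁ : List (Atomic P)) (a : Atomic P) (A B : List (DevEdge X)) (H₁ : List (DevCell X)),
      Ascending w L₁ a.top (A ++ c.path ++ B) H₁ ∧ a.Adds A B c ∧ w' = a.bot ∧
      e = A ++ c.bot ++ B ∧ (c :: H₁).Perm H ∧ L₁.length + 1 = L.length ∧
      EqList w w' L (L₁ ++ [a]) := by
  induction h with
  | nil => simp at hc
  | @snoc L a e A B d H h he ha ih =>
    by_cases hcd : c = d
    · subst hcd he
      exact ⟨L, a, A, B, H, h, ha, rfl, rfl, .refl _, by simp, .refl (h.snoc rfl ha).composable⟩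
    · obtain ⟨L₁, b, A', B', H₁, h₁, hb, hbot, he', hp, hlen, heq⟩ :=
        ih ((List.mem_cons.1 hc).resolve_left hcd)
          fun d' hd' => hmax d' (List.mem_cons_of_mem _ hd')
      -- By induction `c` is glued last in `L`; it is now moved past `d`.
      obtain ⟨a', b', A₁, B₁, A₂, B₂, ha', hb', e₁, e₂, e₃, t₁, t₂, t₃, hab⟩ :=
        hb.commute ha hbot (he'.symm.trans he) (hmax d List.mem_cons_self)
      rw [← t₁, e₁] at h₁
      have h₂ := h₁.snoc rfl ha'
      rw [← t₂, e₂] at h₂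
      refine ⟨L₁ ++ [a'], b', A₂, B₂, d :: H₁, h₂, hb', t₃.symm, e₃.symm, ?_, ?_, ?_⟩
      · exact (List.Perm.swap _ _ _).trans (hp.cons d)
      · simp [← hlen]
      · have h₃ : EqList w a.bot (L ++ [a]) (L₁ ++ [b] ++ [a]) :=
          heq.append (.refl ⟨rfl, rfl⟩)
        have h₄ : EqList w a.bot (L₁ ++ [b, a]) (L₁ ++ [a', b']) :=
          .append (.refl (t₁ ▸ h₁.composable)) hab
        simpa using h₃.trans (by simpa using h₄)

/-- Equivalent diagrams without dipoles have the same cells. -/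
theorem mem_iff_of_eqList {L' : List (Atomic P)} {e' : List (DevEdge X)} {H' : List (DevCell X)}
    (h : Ascending w L w' e H) (h' : Ascending w L' w' e' H') (hL : EqList w w' L L')
    (c : DevCell X) : c ∈ H ↔ c ∈ H' := by
  have : e = e' := by
    rw [← h.actList_eq, ← h'.actList_eq]
    exact hL.actList_eq (by simp) (reduced_top _)
  have h₁ := h.history_eq
  have h₂ := h'.history_eq
  rw [this, h₂, Set.ext_iff] at h₁
  exact (h₁ c).symm

end Ascending

/-! ### Counting the cells in which two reduced diagrams differ. -/

namespace Ascending

variable {w w' : List X} {L : List (Atomic P)} {e : List (DevEdge X)} {H : List (DevCell X)}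

theorem nodup_path (h : Ascending w L w' e H) : e.Nodup := (List.nodup_append'.1 h.nodup.2).1

/-- A cell whose bottom path is a segment of the developed bottom path has no successors. -/
theorem edge_notMem_path (h : Ascending w L w' e H) {c d : DevCell X} (hc : ∀ x ∈ c.bot, x ∈ e)
    (hd : d ∈ H) (j : ℕ) : c.edge j ∉ d.path := by
  intro hj
  have hmem : c.edge j ∈ H.flatMap DevCell.path := List.mem_flatMap.2 ⟨d, hd, hj⟩
  have := h.perm.mem_iff.1 (List.mem_append_right e hmem)
  rcases List.mem_append.1 this with h' | h'
  · obtain ⟨i, -, hi⟩ := List.mem_map.1 h'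
    cases hi
  · obtain ⟨d', -, hd'⟩ := List.mem_flatMap.1 h'
    obtain ⟨i, hi, hij⟩ := DevCell.mem_bot.1 hd'
    obtain ⟨rfl, rfl⟩ := DevCell.edge_inj.1 hij
    exact (List.nodup_append'.1 h.nodup.2).2.2 (hc _ hd') hmem

open Classical in
/-- Gluing one more atomic diagram changes the set of cells by at most one. -/
theorem exists_step {a : Atomic P} (h : Ascending w L a.top e H) :
    ∃ L' e' H', Ascending w L' a.bot e' H' ∧ EqList w a.bot (L ++ [a]) L' ∧
      (symmDiff H.toFinset H'.toFinset).card ≤ 1 := by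
  obtain ⟨A, t, B, rfl, hA, ht, hB⟩ := exists_append₃ e a.p a.u a.q h.length_eq
  by_cases hf : DevCell.Foldable ⟨t, a.u, a.v⟩
  · obtain ⟨s, hs, hst⟩ := hf
    replace hst : t = DevCell.bot ⟨s, a.v, a.u⟩ := hst
    obtain ⟨c, hc⟩ : ∃ c : DevCell X, c = ⟨s, a.v, a.u⟩ := ⟨_, rfl⟩
    have hcv : c.v = a.u := by rw [hc]
    have hcu : c.u = a.v := by rw [hc]
    rw [← hc] at hst
    subst hst
    have hmem : ∀ x ∈ c.bot, x ∈ A ++ c.bot ++ B := by simp +contextual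
    have hcH : c ∈ H := by
      have := h.history_eq
      rw [Set.ext_iff] at this
      exact (this c).1
        ⟨_, hmem _ (DevCell.edge_zero_mem_bot (hcv ▸ a.u_ne_nil)), .self 0⟩
    -- The cell `c` to be cancelled has its whole bottom path on the boundary, so it can be glued
    -- last. Then `a` is the inverse of that last atomic diagram, and the two form a dipole.
    obtain ⟨L₁, b, A', B', H₁, h₁, hb, hbot, he, hp, -, hL⟩ :=
      h.exists_snoc hcH fun d hd => h.edge_notMem_path hmem hd
    obtain ⟨rfl, rfl⟩ := append_segment_inj h.nodup_path hb.bot_ne_nil he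
    obtain rfl : a = b.inv := by
      have hu : a.u = b.v := by rw [← hcv, hb.v_eq]
      have hv : a.v = b.u := by rw [← hcu, hb.u_eq]
      simp only [Atomic.top, Atomic.bot, hu, List.append_assoc] at hbot
      obtain ⟨h₁, h₂⟩ := List.append_inj hbot (hA.symm.trans hb.length_left)
      exact Atomic.ext h₁ hu hv (List.append_cancel_left h₂)
    refine ⟨L₁, _, H₁, h₁, ?_, ?_⟩
    · have h₂ := hL.append (.refl (L := [b.inv]) (w' := b.top) ⟨rfl, rfl⟩)
      have h₃ := (EqList.refl h₁.composable).append (.dipole b)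
      simp only [List.append_assoc, List.append_nil, List.singleton_append] at h₂ h₃
      exact h₂.trans h₃
    · rw [← List.toFinset_eq_of_perm _ _ hp, List.toFinset_cons]
      refine (Finset.card_le_card (t := {c}) fun d hd => ?_).trans (Finset.card_singleton c).le
      simp only [Finset.mem_symmDiff, Finset.mem_insert, Finset.mem_singleton] at hd ⊢
      tauto
  · refine ⟨_, _, _, h.snoc (c := ⟨t, a.u, a.v⟩) rfl ⟨hA, ht, hB, rfl, rfl, hf⟩,
      .refl (h.composable.append ⟨rfl, rfl⟩), ?_⟩
    rw [List.toFinset_cons]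
    refine (Finset.card_le_card (t := {⟨t, a.u, a.v⟩}) fun d hd => ?_).trans
      (Finset.card_singleton _).le
    simp only [Finset.mem_symmDiff, Finset.mem_insert, Finset.mem_singleton] at hd ⊢
    tauto

-- Iterating `exists_step` with the triangle inequality both produces reduced diagrams and bounds
-- the symmetric difference by the number of cells glued on.
open Classical in
theorem exists_append (h : Ascending w L w' e H) {M : List (Atomic P)} {w'' : List X}
    (hM : Composable M w' w'') :
    ∃ L' e' H', Ascending w L' w'' e' H' ∧ EqList w w'' (L ++ M) L' ∧
      (symmDiff H.toFinset H'.toFinset).card ≤ M.length := by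
  induction M generalizing L w' e H with
  | nil =>
    cases hM
    exact ⟨L, e, H, h, by simpa using .refl h.composable, by simp⟩
  | cons a M ih =>
    obtain ⟨rfl, hM⟩ := hM
    obtain ⟨L₁, e₁, H₁, h₁, hL₁, hc₁⟩ := h.exists_step
    obtain ⟨L₂, e₂, H₂, h₂, hL₂, hc₂⟩ := ih h₁ hM
    refine ⟨L₂, e₂, H₂, h₂, ?_, ?_⟩
    · refine .trans ?_ hL₂
      simpa using hL₁.append (.refl hM)
    · calc _ ≤ (symmDiff H.toFinset H₁.toFinset ∪ symmDiff H₁.toFinset H₂.toFinset).card :=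
            Finset.card_le_card (symmDiff_triangle _ _ _)
        _ ≤ _ := Finset.card_union_le _ _
        _ ≤ _ := by rw [List.length_cons]; omega

open Classical in
theorem card_symmDiff_cons {c : DevCell X} {H H₁ K : List (DevCell X)} (hp : (c :: H₁).Perm H)
    (hH : H.Nodup) (hK : c ∉ K) : (symmDiff H₁.toFinset K.toFinset).card + 1 =
      (symmDiff H.toFinset K.toFinset).card := by
  have hc := (List.nodup_cons.1 (hp.nodup_iff.2 hH)).1
  rw [← List.toFinset_eq_of_perm _ _ hp, List.toFinset_cons]
  rw [← List.mem_toFinset] at hK hc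
  rw [← Finset.card_insert_of_notMem (a := c) (by simp [Finset.mem_symmDiff, hK, hc])]
  congr 1
  ext d
  simp only [Finset.mem_symmDiff, Finset.mem_insert]
  by_cases hd : d = c
  · subst hd
    tauto
  · tauto

open Classical in
/-- Two diagrams differ by at most as many atomic diagrams as there are cells that occur in only
one of them. -/
theorem exists_connecting {w₁ w₂ : List X} {L₁ L₂ : List (Atomic P)} {e₁ e₂ : List (DevEdge X)}
    {H₁ H₂ : List (DevCell X)} (h₁ : Ascending w L₁ w₁ e₁ H₁) (h₂ : Ascending w L₂ w₂ e₂ H₂) :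
    ∃ M, Composable M w₁ w₂ ∧ EqList w w₂ (L₁ ++ M) L₂ ∧
      M.length ≤ (symmDiff H₁.toFinset H₂.toFinset).card := by
  induction hn : L₁.length + L₂.length using Nat.strong_induction_on generalizing
    w₁ w₂ L₁ L₂ e₁ e₂ H₁ H₂ with
  | _ n ih =>
  subst hn
  by_cases h₁₂ : ∃ c ∈ H₁, c ∉ H₂
  -- The cells of the second diagram contain all their predecessors, so a surplus cell without
  -- successors exists. Peeling it off costs one inverse atomic diagram at the start of `M`.
  · obtain ⟨c, hc, hcQ, hmax⟩ := h₁.exists_maximal (Q := {c | c ∈ H₂})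
      (fun d hd c j hj => h₂.mem_of_edge_mem_path hd hj) h₁₂
    obtain ⟨L, a, A, B, H, h, -, rfl, -, hp, hlen, hL⟩ := h₁.exists_snoc hc hmax
    obtain ⟨M, hM, hLM, hcard⟩ := ih _ (by omega) h h₂ rfl
    refine ⟨a.inv :: M, ⟨rfl, hM⟩, ?_, ?_⟩
    · have k₁ := hL.append (.refl (L := a.inv :: M) ⟨rfl, hM⟩)
      have k₂ := (EqList.refl h.composable).append ((EqList.dipole a).append (.refl hM))
      simp only [List.append_assoc, List.nil_append, List.cons_append] at k₁ k₂
      exact (k₁.trans k₂).trans hLM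
    · rw [← card_symmDiff_cons hp h₁.nodup.1 hcQ]
      simpa using hcard
  by_cases h₂₁ : ∃ c ∈ H₂, c ∉ H₁
  · obtain ⟨c, hc, hcQ, hmax⟩ := h₂.exists_maximal (Q := {c | c ∈ H₁})
      (fun d hd c j hj => h₁.mem_of_edge_mem_path hd hj) h₂₁
    obtain ⟨L, a, A, B, H, h, -, rfl, -, hp, hlen, hL⟩ := h₂.exists_snoc hc hmax
    obtain ⟨M, hM, hLM, hcard⟩ := ih _ (by omega) h₁ h rfl
    refine ⟨M ++ [a], hM.append ⟨rfl, rfl⟩, ?_, ?_⟩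
    · rw [← List.append_assoc]
      exact (hLM.append (.refl (L := [a]) ⟨rfl, rfl⟩)).trans hL.symm
    · rw [symmDiff_comm, ← card_symmDiff_cons hp h₂.nodup.1 hcQ, symmDiff_comm]
      simpa using hcard
  push Not at h₁₂ h₂₁
  by_cases hne : H₁ = []
  · have hne' : H₂ = [] := List.eq_nil_iff_forall_not_mem.2 fun c hc => by
      simpa [hne] using h₂₁ c hc
    subst hne hne'
    cases h₁
    cases h₂
    exact ⟨[], rfl, .refl rfl, by simp⟩
  -- Both diagrams now have the same cells, so one cell can be glued last in both. The remainders
  -- again have equal cells and hence are equivalent, and equality of their named bottom paths puts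
  -- the last cell in the same place.
  · obtain ⟨c, hc, -, hmax⟩ := h₁.exists_maximal (Q := ∅) nofun
      (by simpa using List.exists_mem_of_ne_nil _ hne)
    obtain ⟨L, a, A, B, H, h, ha, rfl, -, hp, hlen, hL⟩ := h₁.exists_snoc hc hmax
    obtain ⟨L', a', A', B', H', h', ha', rfl, -, hp', hlen', hL'⟩ :=
      h₂.exists_snoc (h₁₂ c hc) fun d hd => hmax d (h₂₁ d hd)
    obtain ⟨M, hM, hLM, hcard⟩ := ih _ (by omega) h h' rfl
    have hHH : symmDiff H.toFinset H'.toFinset = ∅ := by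
      rw [← Finset.bot_eq_empty, symmDiff_eq_bot]
      have hc₁ := (List.nodup_cons.1 (hp.nodup_iff.2 h₁.nodup.1)).1
      have hc₂ := (List.nodup_cons.1 (hp'.nodup_iff.2 h₂.nodup.1)).1
      ext d
      have e₁ := hp.mem_iff (a := d)
      have e₂ := hp'.mem_iff (a := d)
      have e₃ := h₁₂ d
      have e₄ := h₂₁ d
      simp only [List.mem_cons, List.mem_toFinset] at *
      by_cases hd : d = c
      · subst hd
        tauto
      · tauto
    obtain rfl : M = [] := by simpa [hHH] using hcard
    rw [List.append_nil] at hLM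
    have htop : a.top = a'.top := hM
    have hAA : A ++ c.path ++ B = A' ++ c.path ++ B' := by
      rw [← h.actList_eq, ← h'.actList_eq]
      exact hLM.actList_eq (by simp) (reduced_top _)
    obtain ⟨rfl, rfl⟩ := append_segment_inj h.nodup_path ha.path_ne_nil hAA
    obtain rfl : a = a' := by
      have hu : a.u = a'.u := by rw [← ha.u_eq, ha'.u_eq]
      have hv : a.v = a'.v := by rw [← ha.v_eq, ha'.v_eq]
      simp only [Atomic.top, hu, List.append_assoc] at htop
      obtain ⟨k₁, k₂⟩ := List.append_inj htop (ha.length_left.symm.trans ha'.length_left)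
      exact Atomic.ext k₁ hu hv (List.append_cancel_left k₂)
    refine ⟨[], rfl, ?_, by simp⟩
    rw [List.append_nil]
    exact (hL.trans (hLM.append (.refl ⟨rfl, rfl⟩))).trans hL'.symm

end Ascending

/-! ### Cells of group elements -/

namespace DiagramGroup

variable {w : List X}

theorem numCells_le (Δ : Diagram P w w) : numCells (mk Δ) ≤ Δ.atoms.length :=
  Nat.sInf_le ⟨Δ, rfl, rfl⟩

theorem exists_length_eq_numCells (g : DiagramGroup P w) :
    ∃ Δ : Diagram P w w, mk Δ = g ∧ Δ.atoms.length = numCells g := by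
  obtain ⟨Δ, hΔ⟩ := Quotient.exists_rep g
  exact Nat.sInf_mem (s := {n | ∃ Δ : Diagram P w w, mk Δ = g ∧ Δ.numCells = n})
    ⟨_, Δ, hΔ, rfl⟩

theorem eqList_of_mk_eq {Δ Δ' : Diagram P w w} (h : mk Δ = mk Δ') :
    EqList w w Δ.atoms Δ'.atoms :=
  ⟨Δ.composable, Δ'.composable, Quotient.exact (s := diagramSetoid P w) h⟩

theorem mk_eq_of_eqList {Δ Δ' : Diagram P w w} (h : EqList w w Δ.atoms Δ'.atoms) :
    mk Δ = mk Δ' :=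
  Quotient.sound (s := diagramSetoid P w) h.2.2

theorem exists_ascending (g : DiagramGroup P w) :
    ∃ (Δ : Diagram P w w) (e : List (DevEdge X)) (H : List (DevCell X)),
      mk Δ = g ∧ Ascending w Δ.atoms w e H := by
  obtain ⟨Δ, hΔ⟩ := Quotient.exists_rep g
  obtain ⟨L, e, H, hL, hΔL, -⟩ := Ascending.nil.exists_append Δ.composable
  exact ⟨⟨L, hL.composable⟩, e, H, (mk_eq_of_eqList hΔL.symm).trans hΔ, hL⟩

open Classical in
/-- The diagram metric counts the cells that occur in only one of two reduced diagrams. -/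
theorem exists_card_symmDiff_eq (P : Presentation X) (w : List X) :
    ∃ F : DiagramGroup P w → Finset (DevCell X),
      ∀ g h, (symmDiff (F g) (F h)).card = diagramDist g h := by
  choose Δ e H hΔ hasc using exists_ascending (P := P) (w := w)
  refine ⟨fun g => (H g).toFinset, fun g h => le_antisymm ?_ ?_⟩
  -- Glue a minimal diagram for `g⁻¹ * h` below the diagram of `g`: the reduced result has the same
  -- cells as the diagram of `h`.
  · obtain ⟨Γ, hΓ, hlen⟩ := exists_length_eq_numCells (g⁻¹ * h)
    obtain ⟨L, e', H', hL, hgL, hcard⟩ := (hasc g).exists_append Γ.composable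
    have hmul : mk ((Δ g).concat Γ) = mk (Δ h) := by
      change mk (Δ g) * mk Γ = _
      rw [hΔ, hΓ, hΔ, mul_inv_cancel_left]
    have hH : (H h).toFinset = H'.toFinset := by
      ext c
      rw [List.mem_toFinset, List.mem_toFinset]
      exact (hasc h).mem_iff_of_eqList hL ((eqList_of_mk_eq hmul).symm.trans hgL) c
    simp only [hH, diagramDist]
    rw [← hlen]
    exact hcard
  · obtain ⟨M, hM, hgM, hcard⟩ := (hasc g).exists_connecting (hasc h)
    have hmul : mk ((Δ g).concat ⟨M, hM⟩) = mk (Δ h) := mk_eq_of_eqList hgM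
    have : g⁻¹ * h = mk ⟨M, hM⟩ := by
      rw [inv_mul_eq_iff_eq_mul, ← hΔ h, ← hmul]
      nth_rw 2 [← hΔ g]
      rfl
    rw [diagramDist, this]
    exact (numCells_le _).trans hcard

end DiagramGroup

/-! ### Word lengths -/

section WordLength

variable {G : Type*} [Group G] {S T : Set G}

theorem wordLength_prod_le {l : List G} (hl : ∀ s ∈ l, s ∈ S ∨ s⁻¹ ∈ S) :
    wordLength S l.prod ≤ l.length :=
  Nat.sInf_le ⟨l, hl, rfl, rfl⟩

theorem exists_prod_eq (hS : Subgroup.closure S = ⊤) (g : G) :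
    ∃ l : List G, (∀ s ∈ l, s ∈ S ∨ s⁻¹ ∈ S) ∧ l.prod = g := by
  have hg : g ∈ (Subgroup.closure S).toSubmonoid := hS ▸ Subgroup.mem_top g
  rw [Subgroup.closure_toSubmonoid] at hg
  exact Submonoid.exists_list_of_mem_closure hg

theorem exists_length_eq_wordLength (hS : Subgroup.closure S = ⊤) (g : G) :
    ∃ l : List G, (∀ s ∈ l, s ∈ S ∨ s⁻¹ ∈ S) ∧ l.prod = g ∧ l.length = wordLength S g := by
  obtain ⟨l, hl, hg⟩ := exists_prod_eq hS g
  exact Nat.sInf_mem (s := {n | ∃ l : List G, (∀ s ∈ l, s ∈ S ∨ s⁻¹ ∈ S) ∧ l.prod = g ∧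
    l.length = n}) ⟨_, l, hl, hg, rfl⟩

theorem wordLength_one : wordLength S (1 : G) = 0 :=
  Nat.le_zero.1 (wordLength_prod_le (l := []) nofun)

theorem wordLength_mul_le (hS : Subgroup.closure S = ⊤) (g h : G) :
    wordLength S (g * h) ≤ wordLength S g + wordLength S h := by
  obtain ⟨l, hl, rfl, hlen⟩ := exists_length_eq_wordLength hS g
  obtain ⟨m, hm, rfl, hlen'⟩ := exists_length_eq_wordLength hS h
  rw [← hlen, ← hlen', ← List.length_append, ← List.prod_append]
  refine wordLength_prod_le fun s hs => ?_
  exact (List.mem_append.1 hs).elim (hl s) (hm s)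

theorem wordLength_inv_le (hS : Subgroup.closure S = ⊤) (g : G) :
    wordLength S g⁻¹ ≤ wordLength S g := by
  obtain ⟨l, hl, rfl, hlen⟩ := exists_length_eq_wordLength hS g
  rw [← hlen, List.prod_inv_reverse]
  refine (wordLength_prod_le fun s hs => ?_).trans (by simp)
  simp only [List.mem_reverse, List.mem_map] at hs
  obtain ⟨t, ht, rfl⟩ := hs
  rw [inv_inv]
  exact (hl t ht).symm

/-- Word lengths with respect to finite generating sets are Lipschitz equivalent. -/
theorem exists_wordLength_le_mul (hS : Subgroup.closure S = ⊤) (hT : Subgroup.closure T = ⊤)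
    (hfin : T.Finite) : ∃ K : ℕ, ∀ g, wordLength S g ≤ K * wordLength T g := by
  obtain ⟨K, hK⟩ := (hfin.image (wordLength S)).bddAbove
  have hK' : ∀ s, s ∈ T ∨ s⁻¹ ∈ T → wordLength S s ≤ K := by
    rintro s (hs | hs)
    · exact hK ⟨s, hs, rfl⟩
    · simpa using (wordLength_inv_le hS s⁻¹).trans (hK ⟨_, hs, rfl⟩)
  refine ⟨K, fun g => ?_⟩
  obtain ⟨l, hl, rfl, hlen⟩ := exists_length_eq_wordLength hT g
  rw [← hlen]
  clear hlen
  induction l with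
  | nil => simp [wordLength_one]
  | cons s l ih =>
    rw [List.prod_cons, List.length_cons, mul_add, mul_one, add_comm]
    exact (wordLength_mul_le hS _ _).trans (add_le_add (hK' s (hl s List.mem_cons_self))
      (ih fun t ht => hl t (List.mem_cons_of_mem _ ht)))

/-- Alphabet and relations may be uncountable; countability of the group is what makes a separable
target possible. -/
theorem countable_of_closure_eq_top (hS : Subgroup.closure S = ⊤) (hfin : S.Finite) :
    Countable G := by
  have : Countable {s | s ∈ S ∨ s⁻¹ ∈ S} :=
    (hfin.union hfin.inv).countable.to_subtype
  refine Function.Surjective.countable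
    (f := fun l : List {s | s ∈ S ∨ s⁻¹ ∈ S} => (l.map Subtype.val).prod) fun g => ?_
  obtain ⟨l, hl, hg⟩ := exists_prod_eq hS g
  refine ⟨l.attach.map fun s => ⟨s.1, hl s.1 s.2⟩, ?_⟩
  simp [Function.comp_def, hg]

end WordLength

/-! ### Embeddings into a Hilbert space -/

/-- A Hilbert basis of `ℓ²(ℕ)`. -/
noncomputable def stdBasis : HilbertBasis ℕ ℝ (lp (fun _ : ℕ => ℝ) 2) :=
  .ofRepr (.refl ℝ _)

theorem separableSpace_l2 : TopologicalSpace.SeparableSpace (lp (fun _ : ℕ => ℝ) 2) := by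
  rw [← TopologicalSpace.isSeparable_univ_iff]
  have h := ((Set.countable_range stdBasis).isSeparable.span (R := ℝ)).closure
  rwa [← Submodule.topologicalClosure_coe, stdBasis.dense_span, Submodule.top_coe] at h

/-- The common terms cancel, and coefficients ±1 remain on the symmetric difference. -/
theorem norm_sq_sum_sub_sum {ι E : Type*} [DecidableEq ι] [NormedAddCommGroup E]
    [InnerProductSpace ℝ E] {v : ι → E} (hv : Orthonormal ℝ v) (A B : Finset ι) :
    ‖∑ i ∈ A, v i - ∑ i ∈ B, v i‖ ^ 2 = (symmDiff A B).card := by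
  let l : ι → ℝ := fun i => (if i ∈ A then 1 else 0) - if i ∈ B then 1 else 0
  have h : ∑ i ∈ A, v i - ∑ i ∈ B, v i = ∑ i ∈ A ∪ B, l i • v i := by
    simp only [l, sub_smul, Finset.sum_sub_distrib, ite_smul, one_smul, zero_smul,
      Finset.sum_ite_mem, Finset.union_inter_cancel_left, Finset.union_inter_cancel_right]
  have hl : ∀ i, l i * l i = if i ∈ symmDiff A B then 1 else 0 := by
    intro i
    by_cases hA : i ∈ A <;> by_cases hB : i ∈ B <;> simp [l, hA, hB, Finset.mem_symmDiff]
  rw [h, ← real_inner_self_eq_norm_sq, hv.inner_sum]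
  simp only [conj_trivial, hl, Finset.sum_ite_mem, Finset.sum_const, nsmul_eq_mul, mul_one]
  congr 2
  exact Finset.inter_eq_right.2 symmDiff_le_sup

open Classical in
/-- A countable family of finite sets, with the cardinality of symmetric differences as distance,
is mapped to `ℓ²(ℕ)` so that the square of the norm is the distance. -/
theorem exists_norm_sq_eq_card_symmDiff {G K : Type*} [Countable G] (F : G → Finset K) :
    ∃ f : G → lp (fun _ : ℕ => ℝ) 2,
      ∀ g h, ‖f g - f h‖ ^ 2 = ((symmDiff (F g) (F h)).card : ℝ) := by
  -- Only countably many elements of `K` occur, so they can index basis vectors of `ℓ²(ℕ)`.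
  have hc : (⋃ g, (F g : Set K)).Countable :=
    Set.countable_iUnion fun g => (F g).countable_toSet
  obtain ⟨ι, hι⟩ := Set.countable_iff_exists_injOn.1 hc
  have hi (g h : G) : Set.InjOn ι (F g ∪ F h : Finset K) :=
    hι.mono (by
      rw [Finset.coe_union]
      exact Set.union_subset (Set.subset_iUnion (fun g => (F g : Set K)) g)
        (Set.subset_iUnion (fun g => (F g : Set K)) h))
  refine ⟨fun g => ∑ i ∈ (F g).image ι, stdBasis i, fun g h => ?_⟩
  rw [norm_sq_sum_sub_sum stdBasis.orthonormal, ← Finset.card_image_of_injOn (f := ι)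
    ((hi g h).mono (by exact_mod_cast (symmDiff_le_sup : symmDiff (F g) (F h) ≤ _)))]
  congr 2
  ext n
  have key : ∀ x ∈ F g ∪ F h, ∀ y ∈ F g ∪ F h, ι x = ι y → x = y := fun x hx y hy => hi g h hx hy
  simp only [Finset.mem_symmDiff, Finset.mem_image, Finset.mem_union] at key ⊢
  constructor
  · rintro (⟨⟨x, hx, rfl⟩, hn⟩ | ⟨⟨x, hx, rfl⟩, hn⟩)
    · exact ⟨x, .inl ⟨hx, fun hx' => hn ⟨x, hx', rfl⟩⟩, rfl⟩
    · exact ⟨x, .inr ⟨hx, fun hx' => hn ⟨x, hx', rfl⟩⟩, rfl⟩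
  · rintro ⟨x, ⟨hx, hn⟩ | ⟨hx, hn⟩, rfl⟩
    · refine .inl ⟨⟨x, hx, rfl⟩, ?_⟩
      rintro ⟨y, hy, hxy⟩
      exact hn (key y (.inr hy) x (.inl hx) hxy ▸ hy)
    · refine .inr ⟨⟨x, hx, rfl⟩, ?_⟩
      rintro ⟨y, hy, hxy⟩
      exact hn (key y (.inl hy) x (.inr hx) hxy ▸ hy)

/-- A map for which the square of the norm is Lipschitz equivalent to the word metric witnesses
compression `1 / 2`. -/
theorem hasCompression_half {G : Type*} [Group G] {S : Set G}
    (f : G → lp (fun _ : ℕ => ℝ) 2) (d : G → G → ℕ) (hf : ∀ g h, ‖f g - f h‖ ^ 2 = (d g h : ℝ))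
    {a b : ℝ≥0} (ha : 0 < a) (hb : 0 < b) (h₁ : ∀ g h, (wordDist S g h : ℝ≥0) ≤ a * d g h)
    (h₂ : ∀ g h, (d g h : ℝ≥0) ≤ b * wordDist S g h) : HasCompression S (1 / 2) := by
  have hf' (g h : G) : ‖f g - f h‖₊ ^ 2 = (d g h : ℝ≥0) := by
    ext
    simpa using hf g h
  have hhalf : (0 : ℝ) < ((1 / 2 : ℝ≥0) : ℝ) := by norm_num
  have hC : 0 < (NNReal.sqrt a)⁻¹ := inv_pos.2 (NNReal.sqrt_pos.2 ha)
  refine ⟨_, inferInstance, inferInstance, inferInstance, separableSpace_l2, f,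
    (NNReal.sqrt a)⁻¹, b, hC, hb, ?_, ?_, fun g h => ?_, fun g h => ?_, ?_, ?_⟩
  · exact fun x y hxy => mul_le_mul_right (NNReal.rpow_le_rpow hxy hhalf.le) _
  · exact fun x y hxy => mul_le_mul_right hxy _
  · have : ((1 / 2 : ℝ≥0) : ℝ) = 1 / 2 := by norm_num
    rw [this, ← NNReal.sqrt_eq_rpow, inv_mul_le_iff₀ (NNReal.sqrt_pos.2 ha),
      ← NNReal.sqrt_sq ‖f g - f h‖₊, ← NNReal.sqrt_mul, hf']
    exact NNReal.sqrt_le_sqrt.2 (h₁ g h)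
  -- The norm is the square root of the natural number `d g h`, hence at most `d g h`.
  · refine le_trans ?_ (h₂ g h)
    rw [← pow_le_pow_iff_left₀ zero_le zero_le two_ne_zero, hf']
    exact_mod_cast Nat.le_self_pow two_ne_zero _
  · refine Filter.Tendsto.const_mul_atTop hC ?_
    exact (NNReal.orderIsoRpow _ hhalf).tendsto_atTop
  · exact Filter.Tendsto.const_mul_atTop hb Filter.tendsto_id

end DiagramGroups

theorem theorem2 {X : Type*} (P : DiagramGroups.Presentation X) (w : List X) (hw : w ≠ [])
    (hB : DiagramGroups.PropertyB P w)
    (S : Set (DiagramGroups.DiagramGroup P w)) (hS : S.Finite)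
    (hSgen : Subgroup.closure S = ⊤) :
    1 / 2 ≤ DiagramGroups.hilbertCompression S := by
  open DiagramGroups in
  obtain ⟨T, hT, hTgen, c, hc, hdist⟩ := hB
  have := countable_of_closure_eq_top hSgen hS
  obtain ⟨F, hF⟩ := DiagramGroup.exists_card_symmDiff_eq P w
  obtain ⟨f, hf⟩ := exists_norm_sq_eq_card_symmDiff F
  obtain ⟨K, hK⟩ := exists_wordLength_le_mul hSgen hTgen hT
  obtain ⟨K', hK'⟩ := exists_wordLength_le_mul hTgen hSgen hS
  lift c to ℝ≥0 using hc.le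
  have h : HasCompression S (1 / 2) := by
    -- `K` and `K'` compare the word metrics of `S` and `T`; they may be zero, and adding one makes
    -- the constants positive.
    refine hasCompression_half f DiagramGroup.diagramDist (fun g h => by rw [hf, hF])
      (a := (K + 1) * c) (b := c * (K' + 1)) (mul_pos (by positivity) (by exact_mod_cast hc))
      (mul_pos (by exact_mod_cast hc) (by positivity)) (fun g h => ?_) fun g h => ?_
    · have h₁ : (wordDist T g h : ℝ≥0) ≤ c * DiagramGroup.diagramDist g h := by
        exact_mod_cast (hdist g h).2
      have h₂ : (wordDist S g h : ℝ≥0) ≤ K * wordDist T g h := by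
        exact_mod_cast hK (g⁻¹ * h)
      calc (wordDist S g h : ℝ≥0) ≤ K * wordDist T g h := h₂
        _ ≤ (K + 1) * (c * DiagramGroup.diagramDist g h) := by gcongr; simp
        _ = _ := (mul_assoc _ _ _).symm
    · have h₁ : (DiagramGroup.diagramDist g h : ℝ≥0) ≤ c * wordDist T g h := by
        exact_mod_cast (hdist g h).1
      have h₂ : (wordDist T g h : ℝ≥0) ≤ K' * wordDist S g h := by
        exact_mod_cast hK' (g⁻¹ * h)
      calc (DiagramGroup.diagramDist g h : ℝ≥0) ≤ c * wordDist T g h := h₁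
        _ ≤ c * ((K' + 1) * wordDist S g h) := by
          gcongr
          exact h₂.trans (by gcongr; simp)
        _ = _ := (mul_assoc _ _ _).symm
  refine le_trans ?_ (le_iSup₂ (f := fun (α : ℝ≥0) (_ : HasCompression S α) => (α : ℝ≥0∞)) _ h)
  simp
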